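/- Let $\varphi:\mathbb{R}^n\to(-\infty,\infty]$ be a proper function, let $\bar x\in\operatorname{dom}\varphi:=\{x\mid\varphi(x)<\infty\}$, and let $\bar v\in\partial\varphi(\bar x)$. Here, for $x\in\operatorname{dom}\varphi$, $$\widehat\partial\varphi(x):=\Big\{v\in\mathbb{R}^n\ \Big|\ \liminf_{y\to x}\frac{\varphi(y)-\varphi(x)-\langle v,y-x\rangle}{\|y-x\|}\ge 0\Big\}$$ is the regular subdifferential of $\varphi$ at $x$, and the limiting subdifferential $\partial\varphi(x)$ is the set of all limits $v=\lim_k v_k$ with $v_k\in\widehat\partial\varphi(x_k)$, $x_k\to x$ and $\varphi(x_k)\to\varphi(x)$; both sets are empty for $x\notin\operatorname{dom}\varphi$. For a set $\Omega$ with indicator function $\delta_\Omega$ (equal to $0$ on $\Omega$ and to $\infty$ off $\Omega$) and $p\in\Omega$, put $\widehat N_\Omega(p):=\widehat\partial\delta_\Omega(p)$ and $N_\Omega(p):=\partial\delta_\Omega(p)$. For $(x,y)\in\operatorname{gph}\partial\varphi:=\{(x,y)\mid y\in\partial\varphi(x)\}$ and $w\in\mathbb{R}^n$, the combined and the limiting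 second-order subdifferentials are $$\breve\partial^2\varphi(x,y)(w):=\big\{z\mid (z,-w)\in\widehat N_{\operatorname{gph}\partial\varphi}(x,y)\big\},\qquad \partial^2\varphi(x,y)(w):=\big\{z\mid (z,-w)\in N_{\operatorname{gph}\partial\varphi}(x,y)\big\}.$$ With $\mathbb{B}_\varepsilon(a)$ the closed ball of center $a$ and radius $\varepsilon$, the function $\varphi$ is called - subdifferentially continuous at $\bar x$ for $\bar v$ if for every $\varepsilon>0$ there is $\delta>0$ such that $|\varphi(x)-\varphi(\bar x)|<\varepsilon$ for all $(x,v)\in\operatorname{gph}\partial\varphi\cap(\mathbb{B}_\delta(\bar x)\times\mathbb{B}_\delta(\bar v))$; - prox-regular at $\bar x$ for $\bar v$ if $\varphi$ is lower semicontinuous (l.s.c.) and there are $\varepsilon>0$ and $r\ge0$ such that $\varphi(x)\ge\varphi(u)+\langle v,x-u\rangle-\frac r2\|x-u\|^2$ for all $x\in\mathbb{B}_\varepsilon(\bar x)$ and all $(u,v)\in\operatorname{gph}\partial\varphi\cap(\mathbb{B}_\varepsilon(\bar x)\times\mathbb{B}_\varepsilon(\bar v))$ with $\varphi(u)<\varphi(\bar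 x)+\varepsilon$; - variationally convex at $\bar x$ for $\bar v$ if $\varphi$ is l.s.c. and there are convex neighborhoods $U$ of $\bar x$ and $V$ of $\bar v$, a proper function $\psi:\mathbb{R}^n\to(-\infty,\infty]$ that is l.s.c. and convex on $U$ with $\psi\le\varphi$ on $U$, and a number $\varepsilon>0$ such that, for $U_\varepsilon:=\{x\in U\mid\varphi(x)<\varphi(\bar x)+\varepsilon\}$, $$(U_\varepsilon\times V)\cap\operatorname{gph}\partial\varphi=(U\times V)\cap\operatorname{gph}\partial\psi\quad\text{and}\quad\varphi(x)=\psi(x)\ \text{at the common elements }(x,v).$$ **Theorem 5.2.** Suppose that $\varphi$ is subdifferentially continuous at $\bar x$ for $\bar v$. Then the following assertions are equivalent: (i) $\varphi$ is variationally convex at $\bar x$ for $\bar v$. (ii) $\varphi$ is prox-regular at $\bar x$ for $\bar v$, and there are neighborhoods $U$ of $\bar x$ and $V$ of $\bar v$ such that $\langle z,w\rangle\ge0$ whenever $z\in\breve\partial^2\varphi(x,y)(w)$, $(x,y)\in\operatorname{gph}\partial\varphi\cap(U\times V)$ and $w\in\mathbb{R}^n$. (iii) $\varphi$ is prox-regular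 at $\bar x$ for $\bar v$, and there are neighborhoods $U$ of $\bar x$ and $V$ of $\bar v$ such that $\langle z,w\rangle\ge0$ whenever $z\in\partial^2\varphi(x,y)(w)$, $(x,y)\in\operatorname{gph}\partial\varphi\cap(U\times V)$ and $w\in\mathbb{R}^n$. -/

import Mathlib

open Filter Topology

noncomputable section

namespace VarAnalysis

section General

variable {E F : Type*} [NormedAddCommGroup E] [InnerProductSpace ℝ E]
  [NormedAddCommGroup F] [InnerProductSpace ℝ F]

/-- A proper extended-real-valued function: values in `(-∞, ∞]`, not identically `∞`. -/
def IsProper (φ : E → EReal) : Prop :=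
  (∀ x, φ x ≠ ⊥) ∧ ∃ x, φ x ≠ ⊤

/-- The regular (Fréchet) subdifferential of `φ` at a point `x` where `φ` is finite:
the vectors `v` with `liminf_{y → x} (φ y - φ x - ⟪v, y - x⟫) / ‖y - x‖ ≥ 0`, i.e. with
`φ y ≥ φ x + ⟪v, y - x⟫ - ε ‖y - x‖` for all `y` near `x`, for each `ε > 0`.
It is empty where `φ` is not finite. -/
def regularSubdifferential (φ : E → EReal) (x : E) : Set E :=
  {v | φ x ≠ ⊥ ∧ φ x ≠ ⊤ ∧ ∀ ε : ℝ, 0 < ε → ∀ᶠ y in 𝓝 x,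
    φ x + ((inner ℝ v (y - x) - ε * ‖y - x‖ : ℝ) : EReal) ≤ φ y}

/-- The limiting (Mordukhovich) subdifferential of `φ` at a point `x` where `φ` is finite:
limits of regular subgradients `v_k` at points `x_k → x` with `φ x_k → φ x`.
It is empty where `φ` is not finite. -/
def limitingSubdifferential (φ : E → EReal) (x : E) : Set E :=
  {v | φ x ≠ ⊥ ∧ φ x ≠ ⊤ ∧ ∃ (xs vs : ℕ → E),
    Tendsto xs atTop (𝓝 x) ∧ Tendsto (fun k => φ (xs k)) atTop (𝓝 (φ x)) ∧
    (∀ k, vs k ∈ regularSubdifferential φ (xs k)) ∧ Tendsto vs atTop (𝓝 v)}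

open Classical in
/-- The indicator function `δ_Ω` of convex analysis: `0` on `Ω`, `∞` off `Ω`. -/
def indicatorFun (Ω : Set E) (x : E) : EReal := if x ∈ Ω then 0 else ⊤

/-- The regular normal cone (empty at points outside `Ω`). -/
def regularNormalCone (Ω : Set E) (x : E) : Set E :=
  regularSubdifferential (indicatorFun Ω) x

/-- The limiting normal cone (empty at points outside `Ω`). -/
def limitingNormalCone (Ω : Set E) (x : E) : Set E :=
  limitingSubdifferential (indicatorFun Ω) x

/-- The graph of a set-valued mapping, in the product with its Euclidean structure. -/
def graph (T : E → Set F) : Set (WithLp 2 (E × F)) :=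
  {p | p.snd ∈ T p.fst}

/-- The regular coderivative of `T` at `(x, y)`, evaluated at `w`. -/
def regularCoderivative (T : E → Set F) (x : E) (y : F) (w : F) : Set E :=
  {z | WithLp.toLp 2 (z, -w) ∈ regularNormalCone (graph T) (WithLp.toLp 2 (x, y))}

/-- The limiting coderivative of `T` at `(x, y)`, evaluated at `w`. -/
def limitingCoderivative (T : E → Set F) (x : E) (y : F) (w : F) : Set E :=
  {z | WithLp.toLp 2 (z, -w) ∈ limitingNormalCone (graph T) (WithLp.toLp 2 (x, y))}

/-- The combined second-order subdifferential: regular coderivative of the limiting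
subdifferential mapping. -/
def combinedSecondSubdifferential (φ : E → EReal) (x y w : E) : Set E :=
  regularCoderivative (limitingSubdifferential φ) x y w

/-- The limiting second-order subdifferential: limiting coderivative of the limiting
subdifferential mapping. -/
def limitingSecondSubdifferential (φ : E → EReal) (x y w : E) : Set E :=
  limitingCoderivative (limitingSubdifferential φ) x y w

/-- Convexity of an extended-real-valued function on a set. -/
def IsConvexFunOn (ψ : E → EReal) (U : Set E) : Prop :=
  Convex ℝ U ∧ ∀ x ∈ U, ∀ y ∈ U, ∀ t : ℝ, 0 ≤ t → t ≤ 1 →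
    ψ ((1 - t) • x + t • y) ≤ ((1 - t : ℝ) : EReal) * ψ x + (t : EReal) * ψ y

/-- Prox-regularity of the l.s.c. function `φ` at `xb` for the subgradient `vb`. -/
def IsProxRegularAt (φ : E → EReal) (xb vb : E) : Prop :=
  LowerSemicontinuous φ ∧ vb ∈ limitingSubdifferential φ xb ∧
  ∃ ε > (0 : ℝ), ∃ r ≥ (0 : ℝ),
    ∀ x ∈ Metric.closedBall xb ε, ∀ u ∈ Metric.closedBall xb ε, ∀ v ∈ Metric.closedBall vb ε,
      v ∈ limitingSubdifferential φ u → φ u < φ xb + (ε : EReal) →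
      φ u + ((inner ℝ v (x - u) - r / 2 * ‖x - u‖ ^ 2 : ℝ) : EReal) ≤ φ x

/-- Subdifferential continuity of `φ` at `xb` for the subgradient `vb`. All values of `φ` that
occur are finite, as `φ` has limiting subgradients only at points where it is finite. -/
def IsSubdiffContinuousAt (φ : E → EReal) (xb vb : E) : Prop :=
  vb ∈ limitingSubdifferential φ xb ∧
  ∀ ε > (0 : ℝ), ∃ δ > (0 : ℝ),
    ∀ x ∈ Metric.closedBall xb δ, ∀ v ∈ Metric.closedBall vb δ,
      v ∈ limitingSubdifferential φ x → |(φ x).toReal - (φ xb).toReal| < ε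

/-- Variational convexity of the l.s.c. function `φ` at `xb` for the subgradient `vb`. The set
`U_ε` of points `x ∈ U` with `φ x < φ xb + ε` is written out. -/
def IsVariationallyConvexAt (φ : E → EReal) (xb vb : E) : Prop :=
  LowerSemicontinuous φ ∧ vb ∈ limitingSubdifferential φ xb ∧
  ∃ U ∈ 𝓝 xb, ∃ V ∈ 𝓝 vb, Convex ℝ U ∧ Convex ℝ V ∧
  ∃ ψ : E → EReal, IsProper ψ ∧ LowerSemicontinuousOn ψ U ∧ IsConvexFunOn ψ U ∧
    (∀ x ∈ U, ψ x ≤ φ x) ∧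
    ∃ ε > (0 : ℝ),
      (∀ x ∈ U, ∀ v ∈ V,
        (φ x < φ xb + (ε : EReal) ∧ v ∈ limitingSubdifferential φ x) ↔
          v ∈ limitingSubdifferential ψ x) ∧
      (∀ x ∈ U, ∀ v ∈ V, v ∈ limitingSubdifferential ψ x → φ x = ψ x)

/-- Positive semidefiniteness of a second-order construction `D` at the points `(x, y)` of the
graph of the limiting subdifferential of `φ` in a neighborhood of `(xb, vb)`. -/
def IsPosSemidefNear (D : E → E → E → Set E) (φ : E → EReal) (xb vb : E) : Prop :=
  ∃ U ∈ 𝓝 xb, ∃ V ∈ 𝓝 vb, ∀ x ∈ U, ∀ y ∈ V, y ∈ limitingSubdifferential φ x →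
    ∀ w : E, ∀ z ∈ D x y w, 0 ≤ inner ℝ z w

end General

end VarAnalysis

end

noncomputable section

namespace VarAnalysis

/-! Everything passes through one condition, `HasQuadraticMinorantsNear` with modulus `0`: near
`(xb, vb)` every subgradient gives an affine minorant of `φ` on a ball. Subdifferential continuity
removes the restriction to low values of `φ`, so prox-regularity becomes the same condition with
some modulus `r`.

Variational convexity yields modulus `0`, because subgradient inequalities of the convex `ψ`
transfer to `φ`. Conversely, the supremum of the affine minorants serves as `ψ`.

Modulus `0` makes the subdifferential locally monotone, and `exists_perturbed_subgradient` solves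
the resolvent equation near each graph point. Moving along the graph in the Minty direction `z - w`
then gives `‖z - w‖ ≤ ‖z + w‖` for every regular coderivative pair, that is, `0 ≤ ⟪z, w⟫`. The
limiting version follows by taking limits, and contains the combined one.

The hard direction recovers monotonicity from positive semidefiniteness. With `s = r + 1`,
prox-regularity gives a single-valued, 1-Lipschitz local inverse `J` of `s • I + ∂φ`. Set `R q = (2
* s) • J q - q`, a Cayley transform. Semidefiniteness says exactly that regular subgradients of `⟪c,
R ·⟫` have norm at most `‖c‖`; a mean value argument makes `R` nonexpansive, which is monotonicity
of `∂φ`. Finally `zero_of_monotone` lowers the modulus from `r` to `0` by a penalized minimization.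
-/

theorem exists_coe_eq {a : EReal} (h₁ : a ≠ ⊥) (h₂ : a ≠ ⊤) : ∃ r : ℝ, a = r :=
  ⟨a.toReal, (EReal.coe_toReal h₂ h₁).symm⟩

theorem exists_min_add_coe {E : Type*} [TopologicalSpace E] {φ : E → EReal} {K : Set E} (hK : IsCompact K) (hne : K.Nonempty)
    (hφ : LowerSemicontinuousOn φ K) {θ : E → ℝ} (hθ : Continuous θ) :
    ∃ u ∈ K, ∀ y ∈ K, φ u + (θ u : EReal) ≤ φ y + (θ y : EReal) := by
  have hsum : LowerSemicontinuousOn (fun x => φ x + (θ x : EReal)) K := by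
    refine hφ.add' (((continuous_coe_real_ereal.comp hθ).lowerSemicontinuous).lowerSemicontinuousOn K) ?_
    intro x _
    exact EReal.continuousAt_add (Or.inr (EReal.coe_ne_bot _)) (Or.inr (EReal.coe_ne_top _))
  obtain ⟨u, hu, hmin⟩ := hsum.exists_isMinOn hne hK
  exact ⟨u, hu, fun y hy => hmin hy⟩

/-! ### Regular subgradients obtained by penalized minimization over balls. -/

section Calculus

variable {E : Type*} [NormedAddCommGroup E] [InnerProductSpace ℝ E]

theorem regularSubdifferential_subset_limiting (φ : E → EReal) (x : E) :
    regularSubdifferential φ x ⊆ limitingSubdifferential φ x := fun v hv =>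
  ⟨hv.1, hv.2.1, fun _ => x, fun _ => v, tendsto_const_nhds, tendsto_const_nhds,
    fun _ => hv, tendsto_const_nhds⟩

variable [CompleteSpace E]

/-- Fermat's rule combined with the sum rule for a differentiable term: the first-order expansion of
`θ` turns minimality into the defining inequality. -/
theorem neg_mem_regularSubdifferential_of_min {φ : E → EReal} {x : E} (h₁ : φ x ≠ ⊥)
    (h₂ : φ x ≠ ⊤) {θ : E → ℝ} {g : E} (hθ : HasGradientAt θ g x)
    (hmin : ∀ᶠ y in 𝓝 x, φ x + (θ x : EReal) ≤ φ y + (θ y : EReal)) :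
    -g ∈ regularSubdifferential φ x := by
  refine ⟨h₁, h₂, fun ε hε => ?_⟩
  obtain ⟨a, ha⟩ := exists_coe_eq h₁ h₂
  rw [hasGradientAt_iff_isLittleO] at hθ
  filter_upwards [hmin, hθ.def hε] with y hy hy'
  rw [ha] at hy ⊢
  rw [Real.norm_eq_abs] at hy'
  have h3 := (abs_le.1 hy').2
  rw [inner_neg_left]
  revert hy
  generalize φ y = c
  intro hy
  induction c using EReal.rec with
  | bot => simp [← EReal.coe_add] at hy
  | coe c =>
    norm_cast at hy ⊢
    linarith
  | top => simp

/-- Taking the penalty as a function of the squared norm keeps the gradient formula valid at the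
center `b` as well. -/
theorem hasGradientAt_radial_sub_inner {h : ℝ → ℝ} {h' : ℝ} {x b : E} (v : E)
    (hh : HasDerivAt h h' (‖x - b‖ ^ 2)) :
    HasGradientAt (fun y => h (‖y - b‖ ^ 2) - inner ℝ v (y - b)) ((2 * h') • (x - b) - v) x := by
  rw [hasGradientAt_iff_hasFDerivAt]
  have h1 : HasFDerivAt (fun y : E => y - b) (ContinuousLinearMap.id ℝ E) x :=
    (hasFDerivAt_id x).sub_const b
  have h2 := h1.norm_sq
  have h3 := hh.comp_hasFDerivAt x h2
  have h4 := ((innerSL ℝ v).hasFDerivAt (x := x - b)).comp x h1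
  refine (h3.sub h4).congr_fderiv ?_
  ext w
  simp
  ring

/-- A point minimizing a lower semicontinuous function plus a radial penalty and a linear term over
a closed ball, when the boundary is excluded, produces a regular subgradient. -/
theorem exists_min_radial [ProperSpace E] {φ : E → EReal} (hbot : ∀ x, φ x ≠ ⊥) {b : E} {R : ℝ}
    (hR : 0 ≤ R) (hφ : LowerSemicontinuousOn φ (Metric.closedBall b R)) (hb : φ b ≠ ⊤) {h : ℝ → ℝ}
    (hc : Continuous h) (v : E)
    (hbd : ∀ x ∈ Metric.sphere b R,
      φ b + (h 0 : EReal) < φ x + ((h (‖x - b‖ ^ 2) - inner ℝ v (x - b) : ℝ) : EReal)) :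
    ∃ u ∈ Metric.ball b R, φ u ≠ ⊤ ∧
      (∀ y ∈ Metric.closedBall b R,
        φ u + ((h (‖u - b‖ ^ 2) - inner ℝ v (u - b) : ℝ) : EReal) ≤
          φ y + ((h (‖y - b‖ ^ 2) - inner ℝ v (y - b) : ℝ) : EReal)) ∧
      ∀ h', HasDerivAt h h' (‖u - b‖ ^ 2) →
        v - (2 * h') • (u - b) ∈ regularSubdifferential φ u := by
  obtain ⟨u, hu, hmin⟩ := exists_min_add_coe (isCompact_closedBall b R)
    ⟨b, Metric.mem_closedBall_self hR⟩ hφ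
    (θ := fun y => h (‖y - b‖ ^ 2) - inner ℝ v (y - b)) (by fun_prop)
  have hub := hmin b (Metric.mem_closedBall_self hR)
  simp only [sub_self, norm_zero, inner_zero_right, sub_zero, ne_eq, OfNat.ofNat_ne_zero,
    not_false_eq_true, zero_pow] at hub
  have hball : u ∈ Metric.ball b R := by
    by_contra hcon
    have hs : u ∈ Metric.sphere b R := by
      rw [Metric.mem_sphere]
      exact le_antisymm hu (not_lt.1 hcon)
    exact absurd hub (not_le.2 (hbd u hs))
  have htop : φ u ≠ ⊤ := by
    intro ht
    obtain ⟨a, ha⟩ := exists_coe_eq (hbot b) hb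
    rw [ht, ha, EReal.top_add_coe, top_le_iff, ← EReal.coe_add] at hub
    exact EReal.coe_ne_top _ hub
  refine ⟨u, hball, htop, hmin, fun h' hh' => ?_⟩
  have := neg_mem_regularSubdifferential_of_min (hbot u) htop
    (hasGradientAt_radial_sub_inner v hh') (by
      filter_upwards [Metric.isOpen_ball.mem_nhds hball] with y hy
      exact hmin y (Metric.ball_subset_closedBall hy))
  rwa [neg_sub] at this

/-- Solvability of perturbed generalized equations under a quadratic lower bound. -/
theorem exists_perturbed_subgradient [ProperSpace E] {φ : E → EReal} (hbot : ∀ x, φ x ≠ ⊥)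
    (hφ : LowerSemicontinuous φ) {x y e : E} {r R : ℝ} (hx : φ x ≠ ⊤)
    (hlow : ∀ x' ∈ Metric.closedBall x R,
      φ x + ((inner ℝ y (x' - x) - r / 2 * ‖x' - x‖ ^ 2 : ℝ) : EReal) ≤ φ x')
    (he : 2 * ‖e‖ < R) :
    ∃ u, ‖u - x‖ ≤ 2 * ‖e‖ ∧ y + e - (r + 1) • (u - x) ∈ regularSubdifferential φ u := by
  obtain ⟨a, ha⟩ := exists_coe_eq (hbot x) hx
  have hlow' : ∀ x' ∈ Metric.closedBall x R, ∀ c : ℝ, φ x' = c →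
      a + (inner ℝ y (x' - x) - r / 2 * ‖x' - x‖ ^ 2) ≤ c := by
    intro x' hx' c hc
    have := hlow x' hx'
    rw [ha, hc] at this
    exact_mod_cast this
  have hR : 0 < R := by linarith [norm_nonneg e]
  -- The weight `(r + 1) / 2` beats the defect `r / 2` of the minorant by `1 / 2`. At distance `d`
  -- from `x` the objective exceeds its value at `x` by at least `d ^ 2 / 2 - ‖e‖ * d`, which is
  -- positive once `d > 2 * ‖e‖`.
  obtain ⟨u, hu, htop, hmin, hsub⟩ := exists_min_radial hbot hR.le
    (hφ.lowerSemicontinuousOn _) hx (h := fun t => (r + 1) / 2 * t) (by fun_prop) (y + e) (by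
      intro x' hx'
      by_cases hx't : φ x' = ⊤
      · rw [hx't, ha, EReal.top_add_coe, ← EReal.coe_add]
        exact EReal.coe_lt_top _
      obtain ⟨c, hc⟩ := exists_coe_eq (hbot x') hx't
      have h1 := hlow' x' (Metric.sphere_subset_closedBall hx') c hc
      have h2 : ‖x' - x‖ = R := by rw [← dist_eq_norm]; exact hx'
      have h3 : inner ℝ e (x' - x) ≤ ‖e‖ * ‖x' - x‖ := real_inner_le_norm _ _
      rw [hc, ha, ← EReal.coe_add, ← EReal.coe_add, EReal.coe_lt_coe_iff, inner_add_left]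
      rw [h2] at h1 h3 ⊢
      nlinarith)
  refine ⟨u, ?_, ?_⟩
  · obtain ⟨c, hc⟩ := exists_coe_eq (hbot u) htop
    have h1 := hlow' u (Metric.ball_subset_closedBall hu) c hc
    have h2 := hmin x (Metric.mem_closedBall_self hR.le)
    rw [hc, ha, ← EReal.coe_add, ← EReal.coe_add, EReal.coe_le_coe_iff, inner_add_left] at h2
    simp only [sub_self, norm_zero, inner_zero_right] at h2
    have h3 : inner ℝ e (u - x) ≤ ‖e‖ * ‖u - x‖ := real_inner_le_norm _ _
    by_contra hcon
    push Not at hcon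
    nlinarith [norm_nonneg (u - x), norm_nonneg e]
  · have h := hsub ((r + 1) / 2) (by simpa using (hasDerivAt_id (‖u - x‖ ^ 2)).const_mul ((r + 1) / 2))
    convert h using 3
    ring

end Calculus

/-- Real-valued form of the minorant inequality. -/
theorem add_le_of_coe_add_le {E : Type*} {φ : E → EReal} {u x : E} {a b c : ℝ} (ha : φ u = a) (hb : φ x = b)
    (h : φ u + (c : EReal) ≤ φ x) : a + c ≤ b := by
  rw [ha, hb] at h
  exact_mod_cast h

/-! ### Subgradient inequalities near the reference pair. -/

section Local

variable {E : Type*} [NormedAddCommGroup E] [InnerProductSpace ℝ E]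

/-- Uniform quadratic minorants with modulus `r` at all points of the subdifferential graph in a
neighborhood of `(xb, vb)`. -/
def HasQuadraticMinorantsNear (φ : E → EReal) (xb vb : E) (r : ℝ) : Prop :=
  ∃ ε > (0 : ℝ), ∀ x ∈ Metric.closedBall xb ε, ∀ u ∈ Metric.closedBall xb ε,
    ∀ v ∈ Metric.closedBall vb ε, v ∈ limitingSubdifferential φ u →
      φ u + ((inner ℝ v (x - u) - r / 2 * ‖x - u‖ ^ 2 : ℝ) : EReal) ≤ φ x

theorem IsSubdiffContinuousAt.exists_lt {φ : E → EReal} {xb vb : E}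
    (h : IsSubdiffContinuousAt φ xb vb) {ε : ℝ} (hε : 0 < ε) :
    ∃ δ > (0 : ℝ), ∀ x ∈ Metric.closedBall xb δ, ∀ v ∈ Metric.closedBall vb δ,
      v ∈ limitingSubdifferential φ x → φ x < φ xb + (ε : EReal) := by
  obtain ⟨δ, hδ, H⟩ := h.2 ε hε
  refine ⟨δ, hδ, fun x hx v hv hxv => ?_⟩
  have := (abs_lt.1 (H x hx v hv hxv)).2
  obtain ⟨a, ha⟩ := exists_coe_eq hxv.1 hxv.2.1
  obtain ⟨b, hb⟩ := exists_coe_eq h.1.1 h.1.2.1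
  rw [ha, hb] at this ⊢
  rw [← EReal.coe_add, EReal.coe_lt_coe_iff]
  simp only [EReal.toReal_coe] at this
  linarith

/-- Subdifferential continuity makes the condition `φ u < φ xb + ε` automatic on a smaller
neighborhood. -/
theorem IsProxRegularAt.hasQuadraticMinorantsNear {φ : E → EReal} {xb vb : E}
    (h : IsProxRegularAt φ xb vb) (hsc : IsSubdiffContinuousAt φ xb vb) :
    ∃ r ≥ (0 : ℝ), HasQuadraticMinorantsNear φ xb vb r := by
  obtain ⟨-, -, ε, hε, r, hr, H⟩ := h
  obtain ⟨δ, hδ, Hδ⟩ := hsc.exists_lt hε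
  refine ⟨r, hr, min ε δ, lt_min hε hδ, fun x hx u hu v hv huv => ?_⟩
  have h1 := fun c : E => Metric.closedBall_subset_closedBall (x := c) (min_le_left ε δ)
  have h2 := fun c : E => Metric.closedBall_subset_closedBall (x := c) (min_le_right ε δ)
  exact H x (h1 _ hx) u (h1 _ hu) v (h1 _ hv) huv (Hδ u (h2 _ hu) v (h2 _ hv) huv)

theorem HasQuadraticMinorantsNear.isProxRegularAt {φ : E → EReal} {xb vb : E} {r : ℝ}
    (h : HasQuadraticMinorantsNear φ xb vb r) (hr : 0 ≤ r) (hφ : LowerSemicontinuous φ)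
    (hv : vb ∈ limitingSubdifferential φ xb) : IsProxRegularAt φ xb vb := by
  obtain ⟨ε, hε, H⟩ := h
  exact ⟨hφ, hv, ε, hε, r, hr, fun x hx u hu v hv huv _ => H x hx u hu v hv huv⟩

/-- Add the two minorant inequalities; the function values cancel. For `r = 0` this is monotonicity.
-/
theorem inner_sub_ge_of_minorants {φ : E → EReal} {x x' v v' : E} {r : ℝ}
    (hv : v ∈ limitingSubdifferential φ x) (hv' : v' ∈ limitingSubdifferential φ x')
    (h : φ x + ((inner ℝ v (x' - x) - r / 2 * ‖x' - x‖ ^ 2 : ℝ) : EReal) ≤ φ x')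
    (h' : φ x' + ((inner ℝ v' (x - x') - r / 2 * ‖x - x'‖ ^ 2 : ℝ) : EReal) ≤ φ x) :
    -r * ‖x' - x‖ ^ 2 ≤ inner ℝ (v' - v) (x' - x) := by
  obtain ⟨a, ha⟩ := exists_coe_eq hv.1 hv.2.1
  obtain ⟨b, hb⟩ := exists_coe_eq hv'.1 hv'.2.1
  have h1 := add_le_of_coe_add_le ha hb h
  have h2 := add_le_of_coe_add_le hb ha h'
  rw [← neg_sub x' x, inner_neg_right, norm_neg] at h2
  rw [inner_sub_left]
  linarith

/-- Apply the local inequality at a point `x + t • (y - x)` close to `x`, bound `ψ` there by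
convexity, and divide by `t`. This holds for each tolerance `ε`, which then tends to zero. -/
theorem regular_subgradient_inequality {ψ : E → EReal} {U : Set E} (hbot : ∀ x, ψ x ≠ ⊥)
    (hψ : IsConvexFunOn ψ U) {x y v : E} (hx : x ∈ U) (hy : y ∈ U)
    (hv : v ∈ regularSubdifferential ψ x) : ψ x + ((inner ℝ v (y - x) : ℝ) : EReal) ≤ ψ y := by
  obtain ⟨a, ha⟩ := exists_coe_eq hv.1 hv.2.1
  by_cases htop : ψ y = ⊤
  · simp [htop]
  obtain ⟨b, hb⟩ := exists_coe_eq (hbot y) htop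
  rw [ha, hb, ← EReal.coe_add, EReal.coe_le_coe_iff]
  have key : ∀ ε : ℝ, 0 < ε → inner ℝ v (y - x) - ε * ‖y - x‖ ≤ b - a := by
    intro ε hε
    have hline : Tendsto (fun t : ℝ => x + t • (y - x)) (𝓝[>] 0) (𝓝 x) := by
      have : Continuous fun t : ℝ => x + t • (y - x) := by fun_prop
      simpa using (this.tendsto 0).mono_left nhdsWithin_le_nhds
    have h1 : ∀ᶠ t : ℝ in 𝓝[>] 0, t < 1 :=
      mem_nhdsWithin_of_mem_nhds (Iio_mem_nhds one_pos)
    obtain ⟨t, ht, ht1, ht0⟩ := ((hline.eventually (hv.2.2 ε hε)).and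
      (h1.and self_mem_nhdsWithin)).exists
    have ht0 : 0 < t := ht0
    have hc := hψ.2 x hx y hy t ht0.le ht1.le
    have he : (1 - t) • x + t • y = x + t • (y - x) := by module
    rw [he] at hc
    have := ht.trans hc
    rw [ha, hb, add_sub_cancel_left, inner_smul_right, norm_smul, Real.norm_of_nonneg ht0.le] at this
    norm_cast at this
    have h2 : t * (inner ℝ v (y - x) - ε * ‖y - x‖) ≤ t * (b - a) := by linarith
    exact le_of_mul_le_mul_left h2 ht0
  have hlim : Tendsto (fun ε : ℝ => inner ℝ v (y - x) - ε * ‖y - x‖) (𝓝[>] 0)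
      (𝓝 (inner ℝ v (y - x))) := by
    have : Continuous fun ε : ℝ => inner ℝ v (y - x) - ε * ‖y - x‖ := by fun_prop
    simpa using (this.tendsto 0).mono_left nhdsWithin_le_nhds
  have := le_of_tendsto hlim (eventually_mem_nhdsWithin.mono fun ε hε => key ε hε)
  linarith

theorem limiting_subgradient_inequality {ψ : E → EReal} {U : Set E} (hbot : ∀ x, ψ x ≠ ⊥)
    (hψ : IsConvexFunOn ψ U) {x y v : E} (hx : U ∈ 𝓝 x) (hy : y ∈ U)
    (hv : v ∈ limitingSubdifferential ψ x) : ψ x + ((inner ℝ v (y - x) : ℝ) : EReal) ≤ ψ y := by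
  obtain ⟨h1, h2, xs, vs, hxs, hψs, hreg, hvs⟩ := hv
  by_cases htop : ψ y = ⊤
  · simp [htop]
  obtain ⟨b, hb⟩ := exists_coe_eq (hbot y) htop
  obtain ⟨a, ha⟩ := exists_coe_eq h1 h2
  have hlim : Tendsto (fun k => (ψ (xs k)).toReal + inner ℝ (vs k) (y - xs k)) atTop
      (𝓝 (a + inner ℝ v (y - x))) := by
    have h3 := (EReal.tendsto_toReal h2 h1).comp hψs
    rw [ha, EReal.toReal_coe] at h3
    exact h3.add (hvs.inner (tendsto_const_nhds.sub hxs))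
  have hle : ∀ᶠ k in atTop, (ψ (xs k)).toReal + inner ℝ (vs k) (y - xs k) ≤ b := by
    filter_upwards [hxs hx] with k hk
    obtain ⟨c, hc⟩ := exists_coe_eq (hreg k).1 (hreg k).2.1
    rw [hc, EReal.toReal_coe]
    exact add_le_of_coe_add_le hc hb (regular_subgradient_inequality hbot hψ hk hy (hreg k))
  rw [ha, hb, ← EReal.coe_add, EReal.coe_le_coe_iff]
  exact le_of_tendsto hlim hle

/-- A subgradient of `φ` near the reference pair is one of `ψ` with the same value, so its global
inequality on `U` passes to `φ` through `ψ ≤ φ`. -/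
theorem IsVariationallyConvexAt.hasQuadraticMinorantsNear {φ : E → EReal} {xb vb : E}
    (h : IsVariationallyConvexAt φ xb vb) (hsc : IsSubdiffContinuousAt φ xb vb) :
    HasQuadraticMinorantsNear φ xb vb 0 := by
  obtain ⟨-, -, U, hU, V, hV, -, -, ψ, hψ, -, hconv, hle, ε, hε, hiff, heq⟩ := h
  obtain ⟨δ, hδ, Hδ⟩ := hsc.exists_lt hε
  obtain ⟨ρ, hρ, hρU⟩ := Metric.mem_nhds_iff.1 hU
  obtain ⟨σ, hσ, hσV⟩ := Metric.mem_nhds_iff.1 hV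
  refine ⟨min δ (min (ρ / 2) (σ / 2)), by positivity, fun x hx u hu v hv huv => ?_⟩
  have hm1 : min δ (min (ρ / 2) (σ / 2)) ≤ δ := min_le_left _ _
  have hm2 : min δ (min (ρ / 2) (σ / 2)) < ρ :=
    ((min_le_right _ _).trans (min_le_left _ _)).trans_lt (by linarith)
  have hm3 : min δ (min (ρ / 2) (σ / 2)) < σ :=
    ((min_le_right _ _).trans (min_le_right _ _)).trans_lt (by linarith)
  have huρ := Metric.closedBall_subset_ball hm2 hu
  have hxU := hρU (Metric.closedBall_subset_ball hm2 hx)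
  have hvV := hσV (Metric.closedBall_subset_ball hm3 hv)
  have huψ := (hiff u (hρU huρ) v hvV).1 ⟨Hδ u (Metric.closedBall_subset_closedBall hm1 hu) v
    (Metric.closedBall_subset_closedBall hm1 hv) huv, huv⟩
  rw [heq u (hρU huρ) v hvV huψ]
  simp only [zero_div, zero_mul, sub_zero]
  exact (limiting_subgradient_inequality hψ.1 hconv
    (mem_of_superset (Metric.isOpen_ball.mem_nhds huρ) hρU) hxU huψ).trans (hle x hxU)

end Local

theorem indicatorFun_ne_bot {E : Type*} (Ω : Set E) (x : E) : indicatorFun Ω x ≠ ⊥ := by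
  unfold indicatorFun
  split_ifs <;> simp

theorem indicatorFun_ne_top_iff {E : Type*} {Ω : Set E} {x : E} : indicatorFun Ω x ≠ ⊤ ↔ x ∈ Ω := by
  unfold indicatorFun
  split_ifs with h <;> simp [h]

theorem norm_prod_L2_le {E : Type*} [NormedAddCommGroup E] (p : WithLp 2 (E × E)) : ‖p‖ ≤ ‖p.fst‖ + ‖p.snd‖ := by
  refine abs_le_of_sq_le_sq' ?_ (by positivity) |>.2
  rw [WithLp.prod_norm_sq_eq_of_L2]
  nlinarith [norm_nonneg p.fst, norm_nonneg p.snd]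

/-! ### The convex minorant generated by nearby subgradients. -/

section SecondOrder

variable {E : Type*} [NormedAddCommGroup E] [InnerProductSpace ℝ E]

/-- The supremum of the affine minorants of `φ` given by its subgradients near `(xb, vb)`. -/
def localConvexMinorant (φ : E → EReal) (xb vb : E) (ε : ℝ) (x : E) : EReal :=
  ⨆ p : {p : E × E // p.1 ∈ Metric.closedBall xb ε ∧ p.2 ∈ Metric.closedBall vb ε ∧
    p.2 ∈ limitingSubdifferential φ p.1},
      (((φ p.1.1).toReal + inner ℝ p.1.2 (x - p.1.1) : ℝ) : EReal)

theorem le_localConvexMinorant {φ : E → EReal} {xb vb : E} {ε : ℝ} {u v : E}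
    (hu : u ∈ Metric.closedBall xb ε) (hv : v ∈ Metric.closedBall vb ε)
    (huv : v ∈ limitingSubdifferential φ u) (x : E) :
    φ u + ((inner ℝ v (x - u) : ℝ) : EReal) ≤ localConvexMinorant φ xb vb ε x := by
  obtain ⟨a, ha⟩ := exists_coe_eq huv.1 huv.2.1
  have := le_iSup (fun p : {p : E × E // p.1 ∈ Metric.closedBall xb ε ∧
    p.2 ∈ Metric.closedBall vb ε ∧ p.2 ∈ limitingSubdifferential φ p.1} =>
      (((φ p.1.1).toReal + inner ℝ p.1.2 (x - p.1.1) : ℝ) : EReal)) ⟨(u, v), hu, hv, huv⟩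
  refine le_trans ?_ this
  simp [ha]

theorem lowerSemicontinuous_localConvexMinorant (φ : E → EReal) (xb vb : E) (ε : ℝ) :
    LowerSemicontinuous (localConvexMinorant φ xb vb ε) :=
  lowerSemicontinuous_iSup fun p =>
    (continuous_coe_real_ereal.comp (by fun_prop :
      Continuous fun x => (φ p.1.1).toReal + inner ℝ p.1.2 (x - p.1.1))).lowerSemicontinuous

theorem isConvexFunOn_localConvexMinorant (φ : E → EReal) (xb vb : E) (ε : ℝ) :
    IsConvexFunOn (localConvexMinorant φ xb vb ε) Set.univ := by
  refine ⟨convex_univ, fun x _ y _ t ht ht1 => iSup_le fun p => ?_⟩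
  have h := fun z => le_iSup (fun p : {p : E × E // p.1 ∈ Metric.closedBall xb ε ∧
    p.2 ∈ Metric.closedBall vb ε ∧ p.2 ∈ limitingSubdifferential φ p.1} =>
      (((φ p.1.1).toReal + inner ℝ p.1.2 (z - p.1.1) : ℝ) : EReal)) p
  have h1 : (((1 - t : ℝ)) : EReal) * (((φ p.1.1).toReal + inner ℝ p.1.2 (x - p.1.1) : ℝ) : EReal)
      ≤ ((1 - t : ℝ) : EReal) * localConvexMinorant φ xb vb ε x :=
    mul_le_mul_of_nonneg_left (h x) (by exact_mod_cast sub_nonneg.2 ht1)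
  have h2 : (t : EReal) * (((φ p.1.1).toReal + inner ℝ p.1.2 (y - p.1.1) : ℝ) : EReal)
      ≤ (t : EReal) * localConvexMinorant φ xb vb ε y :=
    mul_le_mul_of_nonneg_left (h y) (by exact_mod_cast ht)
  refine le_trans (le_of_eq ?_) (add_le_add h1 h2)
  rw [← EReal.coe_mul, ← EReal.coe_mul, ← EReal.coe_add]
  congr 1
  have he : (1 - t) • x + t • y - p.1.1 = (1 - t) • (x - p.1.1) + t • (y - p.1.1) := by module
  rw [he, inner_add_right, inner_smul_right, inner_smul_right]
  ring

/-- The supremum `ψ` of the affine minorants agrees with `φ` at their base points, and inherits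
their slopes as subgradients. That `ψ` has no further subgradients nearby is a maximality argument:
local solvability of the resolvent equation for `φ` together with monotonicity of the
subdifferential of `ψ`. -/
theorem HasQuadraticMinorantsNear.isVariationallyConvexAt [ProperSpace E] {φ : E → EReal}
    {xb vb : E} (h : HasQuadraticMinorantsNear φ xb vb 0) (hbot : ∀ x, φ x ≠ ⊥)
    (hφ : LowerSemicontinuous φ) (hsc : IsSubdiffContinuousAt φ xb vb) :
    IsVariationallyConvexAt φ xb vb := by
  obtain ⟨ε, hε, H⟩ := h
  obtain ⟨δ, hδ, Hδ⟩ := hsc.exists_lt one_pos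
  have hmem : xb ∈ Metric.closedBall xb ε := Metric.mem_closedBall_self hε.le
  have hmemv : vb ∈ Metric.closedBall vb ε := Metric.mem_closedBall_self hε.le
  set ψ := localConvexMinorant φ xb vb ε with hψdef
  have hψφ : ∀ x ∈ Metric.closedBall xb ε, ψ x ≤ φ x := by
    intro x hx
    refine iSup_le fun p => ?_
    have := H x hx p.1.1 p.2.1 p.1.2 p.2.2.1 p.2.2.2
    obtain ⟨a, ha⟩ := exists_coe_eq p.2.2.2.1 p.2.2.2.2.1
    simpa [ha] using this
  have hψbot : ∀ x, ψ x ≠ ⊥ := by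
    intro x hx
    have := le_localConvexMinorant hmem hmemv hsc.1 x
    obtain ⟨a, ha⟩ := exists_coe_eq hsc.1.1 hsc.1.2.1
    rw [← hψdef, hx, ha, ← EReal.coe_add, le_bot_iff] at this
    exact EReal.coe_ne_bot _ this
  have hconv : IsConvexFunOn ψ Set.univ := isConvexFunOn_localConvexMinorant φ xb vb ε
  have heq : ∀ u ∈ Metric.closedBall xb ε, ∀ v ∈ Metric.closedBall vb ε,
      v ∈ limitingSubdifferential φ u → φ u = ψ u ∧ v ∈ limitingSubdifferential ψ u := by
    intro u hu v hv huv
    have hval : φ u = ψ u := by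
      refine le_antisymm ?_ (hψφ u hu)
      simpa using le_localConvexMinorant hu hv huv u
    refine ⟨hval, regularSubdifferential_subset_limiting ψ u
      ⟨hψbot u, hval ▸ huv.2.1, fun η hη => Eventually.of_forall fun y => ?_⟩⟩
    refine le_trans ?_ (le_localConvexMinorant hu hv huv y)
    rw [← hval]
    refine add_le_add le_rfl (EReal.coe_le_coe_iff.2 ?_)
    have := mul_nonneg hη.le (norm_nonneg (y - u))
    linarith
  -- The perturbation below has norm at most `2 * κ`, so the solution stays within `4 * κ` of `xb`
  -- and its subgradient within `6 * κ` of `vb`, both inside the `ε`-balls. The bound by `δ` keeps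
  -- `φ` below `φ xb + 1`.
  set κ := min (ε / 10) δ with hκdef
  have hκ : 0 < κ := lt_min (by positivity) hδ
  have hκε : κ ≤ ε / 10 := min_le_left _ _
  have hsub : ∀ c : E, Metric.closedBall c κ ⊆ Metric.closedBall c ε := fun c =>
    Metric.closedBall_subset_closedBall (by linarith)
  have hsubδ : ∀ c : E, Metric.closedBall c κ ⊆ Metric.closedBall c δ := fun c =>
    Metric.closedBall_subset_closedBall (min_le_right _ _)
  have hback : ∀ x ∈ Metric.closedBall xb κ, ∀ v ∈ Metric.closedBall vb κ,
      v ∈ limitingSubdifferential ψ x → v ∈ limitingSubdifferential φ x := by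
    intro x hx v hv hxv
    rw [Metric.mem_closedBall, dist_eq_norm] at hx hv
    have he : ‖(x - xb) + (v - vb)‖ ≤ 2 * κ := by
      linarith [norm_add_le (x - xb) (v - vb)]
    -- Minty's device: solve `x + v ∈ u + ∂φ u`. Then `v + x - u` is also a subgradient of `ψ` at
    -- `u`, and monotonicity against `(x, v)` gives `-‖u - x‖ ^ 2 ≥ 0`.
    obtain ⟨u, hu, hw⟩ := exists_perturbed_subgradient (r := 0) (R := ε) hbot hφ hsc.1.2.1
      (fun x' hx' => H x' hx' xb hmem vb hmemv hsc.1)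
      (e := (x - xb) + (v - vb)) (by linarith)
    have hweq : vb + (x - xb + (v - vb)) - ((0 : ℝ) + 1) • (u - xb) = v + x - u := by module
    rw [hweq] at hw
    have hw := regularSubdifferential_subset_limiting _ _ hw
    have hwn : ‖v + x - u - vb‖ ≤ ε := by
      have h1 : v + x - u - vb = (x - xb + (v - vb)) - (u - xb) := by abel
      rw [h1]
      linarith [norm_sub_le (x - xb + (v - vb)) (u - xb)]
    obtain ⟨-, hwψ⟩ := heq u (by rw [Metric.mem_closedBall, dist_eq_norm]; linarith)
      (v + x - u) (by rwa [Metric.mem_closedBall, dist_eq_norm]) hw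
    have hmono := inner_sub_ge_of_minorants (r := 0) hxv hwψ
      (by
        simpa using limiting_subgradient_inequality (y := u) hψbot hconv univ_mem trivial hxv)
      (by
        simpa using limiting_subgradient_inequality (y := x) hψbot hconv univ_mem trivial hwψ)
    have h2 : v + x - u - v = -(u - x) := by abel
    rw [h2, inner_neg_left, real_inner_self_eq_norm_sq] at hmono
    have h3 : ‖u - x‖ ^ 2 ≤ 0 := by linarith
    have h4 : u = x := by
      rw [← sub_eq_zero, ← norm_eq_zero]
      exact pow_eq_zero_iff two_ne_zero |>.1 (le_antisymm h3 (sq_nonneg _))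
    subst h4
    simpa using hw
  refine ⟨hφ, hsc.1, Metric.closedBall xb κ, Metric.closedBall_mem_nhds _ hκ,
    Metric.closedBall vb κ, Metric.closedBall_mem_nhds _ hκ, convex_closedBall _ _,
    convex_closedBall _ _, ψ, ⟨hψbot, xb, ?_⟩,
    (lowerSemicontinuous_localConvexMinorant φ xb vb ε).lowerSemicontinuousOn _,
    ⟨convex_closedBall _ _, fun x _ y _ => hconv.2 x trivial y trivial⟩,
    fun x hx => hψφ x (hsub _ hx), 1, one_pos, ?_, ?_⟩
  · rw [← (heq xb hmem vb hmemv hsc.1).1]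
    exact hsc.1.2.1
  · intro x hx v hv
    refine ⟨fun h => (heq x (hsub _ hx) v (hsub _ hv) h.2).2, fun h => ?_⟩
    have := hback x hx v hv h
    exact ⟨Hδ x (hsubδ _ hx) v (hsubδ _ hv) this, this⟩
  · intro x hx v hv h
    exact (heq x (hsub _ hx) v (hsub _ hv) (hback x hx v hv h)).1

/-! ### Coderivatives of the subdifferential and positive semidefiniteness. -/

theorem mem_regularNormalCone_iff {Ω : Set E} {x v : E} :
    v ∈ regularNormalCone Ω x ↔ x ∈ Ω ∧ ∀ ε : ℝ, 0 < ε → ∀ᶠ y in 𝓝 x, y ∈ Ω →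
      inner ℝ v (y - x) ≤ ε * ‖y - x‖ := by
  refine ⟨fun h => ⟨indicatorFun_ne_top_iff.1 h.2.1, fun ε hε => ?_⟩, fun h =>
    ⟨indicatorFun_ne_bot _ _, indicatorFun_ne_top_iff.2 h.1, fun ε hε => ?_⟩⟩
  · have hx := indicatorFun_ne_top_iff.1 h.2.1
    filter_upwards [h.2.2 ε hε] with y hy hyΩ
    rw [indicatorFun, indicatorFun, if_pos hx, if_pos hyΩ, zero_add] at hy
    have : inner ℝ v (y - x) - ε * ‖y - x‖ ≤ 0 := by exact_mod_cast hy
    linarith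
  · filter_upwards [h.2 ε hε] with y hy
    by_cases hyΩ : y ∈ Ω
    · rw [indicatorFun, indicatorFun, if_pos h.1, if_pos hyΩ, zero_add]
      have : inner ℝ v (y - x) - ε * ‖y - x‖ ≤ 0 := by linarith [hy hyΩ]
      exact_mod_cast this
    · simp [indicatorFun, hyΩ]

theorem mem_regularCoderivative_iff {T : E → Set E} {x y w z : E} :
    z ∈ regularCoderivative T x y w ↔ y ∈ T x ∧ ∀ ε : ℝ, 0 < ε →
      ∀ᶠ p in 𝓝 (WithLp.toLp 2 (x, y)), p ∈ graph T →
        inner ℝ z (p.fst - x) - inner ℝ w (p.snd - y) ≤ ε * ‖p - WithLp.toLp 2 (x, y)‖ := by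
  rw [regularCoderivative, Set.mem_ofPred_eq, mem_regularNormalCone_iff]
  simp [WithLp.prod_inner_apply, graph, sub_eq_add_neg]

/-- The graph is locally monotone and can be reached in every Minty direction: for small `t` it
contains a point whose increments sum to `t • (z - w)`. Testing the normal cone inequality at that
point suffices. -/
theorem HasQuadraticMinorantsNear.isPosSemidefNear_combined [ProperSpace E] {φ : E → EReal}
    {xb vb : E} (h : HasQuadraticMinorantsNear φ xb vb 0) (hbot : ∀ x, φ x ≠ ⊥)
    (hφ : LowerSemicontinuous φ) :
    IsPosSemidefNear (combinedSecondSubdifferential φ) φ xb vb := by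
  obtain ⟨ε, hε, H⟩ := h
  refine ⟨Metric.ball xb (ε / 2), Metric.ball_mem_nhds _ (by positivity), Metric.ball vb (ε / 2),
    Metric.ball_mem_nhds _ (by positivity), fun x hx y hy hxy w z hz => ?_⟩
  rw [combinedSecondSubdifferential, mem_regularCoderivative_iff] at hz
  rw [Metric.mem_ball, dist_eq_norm] at hx hy
  have hxε : x ∈ Metric.closedBall xb ε := by rw [Metric.mem_closedBall, dist_eq_norm]; linarith
  have hyε : y ∈ Metric.closedBall vb ε := by rw [Metric.mem_closedBall, dist_eq_norm]; linarith
  suffices hd : ‖z - w‖ ≤ ‖z + w‖ by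
    have h1 := norm_sub_sq_real z w
    have h2 := norm_add_sq_real z w
    have h3 := pow_le_pow_left₀ (norm_nonneg _) hd 2
    linarith
  set d := z - w with hddef
  rcases eq_or_lt_of_le (norm_nonneg d) with hd0 | hd0
  · rw [← hd0]; positivity
  have key : ∀ η : ℝ, 0 < η → ‖d‖ - 10 * η ≤ ‖z + w‖ := by
    intro η hη
    obtain ⟨δ, hδ, Hδ⟩ := Metric.eventually_nhds_iff.1 (hz.2 η hη)
    -- The increments have norms at most `2 * t * ‖d‖` and `3 * t * ‖d‖`; this `t` keeps the new
    -- point within `δ` of `(x, y)` and in the region where the minorants hold.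
    set t := min δ (ε / 2) / (10 * ‖d‖) with htdef
    have ht : 0 < t := by positivity
    have htd : 10 * (t * ‖d‖) = min δ (ε / 2) := by rw [htdef]; field_simp
    have hm1 := min_le_left δ (ε / 2)
    have hm2 := min_le_right δ (ε / 2)
    have htd0 : 0 < t * ‖d‖ := by positivity
    have hnorm : ‖t • d‖ = t * ‖d‖ := by rw [norm_smul, Real.norm_of_nonneg ht.le]
    obtain ⟨u, hu, hv⟩ := exists_perturbed_subgradient (r := 0) (R := ε / 2) (x := x) (y := y)
      (e := t • d) hbot hφ hxy.2.1
      (fun x' hx' => H x' (by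
        rw [Metric.mem_closedBall, dist_eq_norm] at hx' ⊢
        have := norm_sub_le_norm_sub_add_norm_sub x' x xb
        linarith) x hxε y hyε hxy) (by rw [hnorm]; linarith)
    have hv := regularSubdifferential_subset_limiting _ _ hv
    rw [zero_add, one_smul] at hv
    set v := y + t • d - (u - x) with hvdef
    have hab : (u - x) + (v - y) = t • d := by rw [hvdef]; abel
    rw [hnorm] at hu
    have hb : ‖v - y‖ ≤ 3 * (t * ‖d‖) := by
      have : v - y = t • d - (u - x) := by rw [hvdef]; abel
      rw [this]
      linarith [norm_sub_le (t • d) (u - x)]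
    have huε : u ∈ Metric.closedBall xb ε := by
      rw [Metric.mem_closedBall, dist_eq_norm]
      linarith [norm_sub_le_norm_sub_add_norm_sub u x xb]
    have hvε : v ∈ Metric.closedBall vb ε := by
      rw [Metric.mem_closedBall, dist_eq_norm]
      linarith [norm_sub_le_norm_sub_add_norm_sub v y vb]
    have hmono := inner_sub_ge_of_minorants hxy hv (H u huε x hxε y hyε hxy)
      (H x hxε u huε v hvε hv)
    have hpn : ‖WithLp.toLp 2 (u, v) - WithLp.toLp 2 (x, y)‖ ≤ 5 * (t * ‖d‖) := by
      refine (norm_prod_L2_le _).trans ?_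
      change ‖u - x‖ + ‖v - y‖ ≤ _
      linarith
    have hnc := Hδ (y := WithLp.toLp 2 (u, v)) (by rw [dist_eq_norm]; linarith) hv
    change inner ℝ z (u - x) - inner ℝ w (v - y) ≤ _ at hnc
    -- Monotonicity in Cayley form: the difference of the increments is no longer than their sum.
    have hdiff : ‖(u - x) - (v - y)‖ ≤ t * ‖d‖ := by
      rw [← hnorm, ← hab]
      refine abs_le_of_sq_le_sq' ?_ (norm_nonneg _) |>.2
      rw [norm_sub_sq_real, norm_add_sq_real, real_inner_comm]
      linarith
    have hcs : inner ℝ (z + w) ((v - y) - (u - x)) ≤ ‖z + w‖ * (t * ‖d‖) := by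
      refine (real_inner_le_norm _ _).trans ?_
      rw [norm_sub_rev]
      exact mul_le_mul_of_nonneg_left hdiff (norm_nonneg _)
    have hdd : inner ℝ d ((u - x) + (v - y)) = t * ‖d‖ ^ 2 := by
      rw [hab, inner_smul_right, real_inner_self_eq_norm_sq]
    have hid : 2 * (inner ℝ z (u - x) - inner ℝ w (v - y)) =
        inner ℝ d ((u - x) + (v - y)) - inner ℝ (z + w) ((v - y) - (u - x)) := by
      rw [hddef]
      simp only [inner_add_left, inner_sub_left, inner_add_right, inner_sub_right]
      ring
    have hηp := mul_le_mul_of_nonneg_left hpn hη.le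
    have hfin : (t * ‖d‖) * (‖d‖ - 10 * η) ≤ (t * ‖d‖) * ‖z + w‖ := by nlinarith
    exact le_of_mul_le_mul_left hfin htd0
  refine le_of_forall_pos_le_add fun η hη => ?_
  linarith [key (η / 10) (by positivity)]

/-- A limiting normal is a limit of regular normals at nearby graph points, and the inner product is
continuous. Passing to interiors ensures that those points eventually lie in the given
neighborhoods. -/
theorem IsPosSemidefNear.limiting {φ : E → EReal} {xb vb : E}
    (h : IsPosSemidefNear (combinedSecondSubdifferential φ) φ xb vb) :
    IsPosSemidefNear (limitingSecondSubdifferential φ) φ xb vb := by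
  obtain ⟨U, hU, V, hV, H⟩ := h
  refine ⟨interior U, interior_mem_nhds.2 hU, interior V, interior_mem_nhds.2 hV,
    fun x hx y hy _ w z hz => ?_⟩
  obtain ⟨-, -, ps, ns, hps, -, hreg, hns⟩ := hz
  have hfst : Continuous fun p : WithLp 2 (E × E) => p.fst :=
    continuous_fst.comp (WithLp.prod_continuous_ofLp 2 E E)
  have hsnd : Continuous fun p : WithLp 2 (E × E) => p.snd :=
    continuous_snd.comp (WithLp.prod_continuous_ofLp 2 E E)
  have h1 := (hfst.tendsto _).comp hps
  have h2 := (hsnd.tendsto _).comp hps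
  have h3 := (hfst.tendsto _).comp hns
  have h4 := (hsnd.tendsto _).comp hns
  have hlim : Tendsto (fun k => inner ℝ (ns k).fst (-(ns k).snd)) atTop (𝓝 (inner ℝ z (- -w))) :=
    h3.inner h4.neg
  rw [neg_neg] at hlim
  refine ge_of_tendsto hlim ?_
  filter_upwards [h1 (isOpen_interior.mem_nhds hx), h2 (isOpen_interior.mem_nhds hy)] with k hk hk'
  refine H (ps k).fst (interior_subset hk) (ps k).snd (interior_subset hk')
    (indicatorFun_ne_top_iff.1 (hreg k).2.1) _ (ns k).fst ?_
  rw [combinedSecondSubdifferential, regularCoderivative, Set.mem_ofPred_eq, neg_neg]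
  exact hreg k

theorem IsPosSemidefNear.combined {φ : E → EReal} {xb vb : E}
    (h : IsPosSemidefNear (limitingSecondSubdifferential φ) φ xb vb) :
    IsPosSemidefNear (combinedSecondSubdifferential φ) φ xb vb := by
  obtain ⟨U, hU, V, hV, H⟩ := h
  exact ⟨U, hU, V, hV, fun x hx y hy hxy w z hz =>
    H x hx y hy hxy w z (regularSubdifferential_subset_limiting _ _ hz)⟩

end SecondOrder

/-! ### Mean value estimates, and from monotonicity to affine minorants. -/

section Integration

variable {E : Type*} [NormedAddCommGroup E] [InnerProductSpace ℝ E]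

/-- A function whose increments are bounded by `L d + C d ^ 2` on a convex set is `L`-Lipschitz
there. -/
theorem sub_le_mul_norm_of_sub_le_quadratic {S : Set E} (hS : Convex ℝ S) {f : E → ℝ} {L C : ℝ}
    (h : ∀ b ∈ S, ∀ u ∈ S, f b - f u ≤ L * ‖u - b‖ + C * ‖u - b‖ ^ 2) {b u : E} (hb : b ∈ S)
    (hu : u ∈ S) : f b - f u ≤ L * ‖u - b‖ := by
  -- Cut the segment into `N + 1` equal pieces and telescope: the linear terms add up to the same
  -- total, while the quadratic ones shrink by the factor `N + 1`.
  have key : ∀ N : ℕ, f b - f u ≤ L * ‖u - b‖ + C * ‖u - b‖ ^ 2 / ((N : ℝ) + 1) := by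
    intro N
    have hN : (0 : ℝ) < (N : ℝ) + 1 := by positivity
    set p : ℕ → E := fun i => AffineMap.lineMap u b ((i : ℝ) / ((N : ℝ) + 1)) with hp
    have hmem : ∀ i ≤ N + 1, p i ∈ S := by
      intro i hi
      refine hS.lineMap_mem hu hb ⟨by positivity, ?_⟩
      rw [div_le_one hN]
      exact_mod_cast hi
    have hstep : ∀ i, ‖p i - p (i + 1)‖ = ‖u - b‖ / ((N : ℝ) + 1) := by
      intro i
      have : p i - p (i + 1) = (1 / ((N : ℝ) + 1)) • (u - b) := by
        simp only [hp, AffineMap.lineMap_apply_module']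
        push_cast
        module
      rw [this, norm_smul, Real.norm_of_nonneg (by positivity)]
      ring
    have hsum : f (p (N + 1)) - f (p 0) ≤
        ∑ _i ∈ Finset.range (N + 1), (L * (‖u - b‖ / ((N : ℝ) + 1)) +
          C * (‖u - b‖ / ((N : ℝ) + 1)) ^ 2) := by
      rw [← Finset.sum_range_sub (fun i => f (p i)) (N + 1)]
      refine Finset.sum_le_sum fun i hi => ?_
      have hi := Finset.mem_range.1 hi
      have := h _ (hmem (i + 1) hi) _ (hmem i hi.le)
      rwa [hstep] at this
    have h0 : p 0 = u := by simp [hp]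
    have h1 : p (N + 1) = b := by
      simp only [hp]
      push_cast
      rw [div_self hN.ne', AffineMap.lineMap_apply_one]
    rw [h0, h1, Finset.sum_const, Finset.card_range, nsmul_eq_mul] at hsum
    refine hsum.trans (le_of_eq ?_)
    push_cast
    field_simp
  have hlim : Tendsto (fun N : ℕ => L * ‖u - b‖ + C * ‖u - b‖ ^ 2 / ((N : ℝ) + 1)) atTop
      (𝓝 (L * ‖u - b‖ + 0)) := by
    refine tendsto_const_nhds.add (tendsto_const_nhds.div_atTop ?_)
    exact tendsto_atTop_add_const_right _ _ tendsto_natCast_atTop_atTop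
  rw [add_zero] at hlim
  exact ge_of_tendsto' hlim key

/-- A continuous function with regular subgradients bounded by `L` is locally `L`-Lipschitz. -/
theorem sub_le_mul_norm_of_regularSubdifferential_bound [ProperSpace E] {f : E → ℝ} {q : E}
    {κ L : ℝ} (hκ : 0 < κ) (hL : 0 ≤ L) (hf : ContinuousOn f (Metric.closedBall q κ))
    (hsub : ∀ p ∈ Metric.ball q κ, ∀ v ∈ regularSubdifferential (fun x => (f x : EReal)) p,
      ‖v‖ ≤ L) {b u : E} (hb : b ∈ Metric.ball q (κ / 4)) (hu : u ∈ Metric.ball q (κ / 4)) :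
    f b - f u ≤ L * ‖u - b‖ := by
  obtain ⟨M, hM⟩ := (isCompact_closedBall q κ).exists_bound_of_continuousOn hf
  have hM0 : 0 ≤ M := (norm_nonneg _).trans (hM q (Metric.mem_closedBall_self hκ.le))
  set R := κ / 2 with hR
  have hR0 : 0 < R := by positivity
  -- On the sphere of radius `R` the quadratic penalty equals `2 * M + 1`, more than the oscillation
  -- of `f`, so the minimizer is interior.
  set C := (2 * M + 1) / R ^ 2 with hC
  have hC0 : 0 < C := by positivity
  have hCR : C * R ^ 2 = 2 * M + 1 := by rw [hC]; field_simp
  refine sub_le_mul_norm_of_sub_le_quadratic (C := C) (convex_ball q (κ / 4)) ?_ hb hu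
  intro b hb u hu
  rw [Metric.mem_ball, dist_eq_norm] at hb hu
  have hbR : Metric.closedBall b R ⊆ Metric.closedBall q κ := by
    intro x hx
    rw [Metric.mem_closedBall, dist_eq_norm] at hx ⊢
    linarith [norm_sub_le_norm_sub_add_norm_sub x b q]
  have hbR' : Metric.ball b R ⊆ Metric.ball q κ := by
    intro x hx
    rw [Metric.mem_ball, dist_eq_norm] at hx ⊢
    linarith [norm_sub_le_norm_sub_add_norm_sub x b q]
  have hcont : LowerSemicontinuousOn (fun x => (f x : EReal)) (Metric.closedBall b R) :=
    (continuous_coe_real_ereal.comp_continuousOn (hf.mono hbR)).lowerSemicontinuousOn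
  obtain ⟨u₀, hu₀, -, hmin, hreg⟩ := exists_min_radial (φ := fun x => (f x : EReal))
    (fun x => EReal.coe_ne_bot _) hR0.le hcont (EReal.coe_ne_top _)
    (h := fun t => L * √t + C * t) (by fun_prop) 0 (by
      intro x hx
      have h1 := abs_le.1 (hM x (hbR (Metric.sphere_subset_closedBall hx)))
      have h2 := abs_le.1 (hM b (hbR (Metric.mem_closedBall_self hR0.le)))
      rw [mem_sphere_iff_norm] at hx
      rw [hx, Real.sqrt_sq hR0.le, ← EReal.coe_add, ← EReal.coe_add, EReal.coe_lt_coe_iff]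
      simp only [Real.sqrt_zero, mul_zero, inner_zero_left]
      have : 0 ≤ L * R := by positivity
      linarith)
  -- A minimizer of `f + L * ‖· - b‖ + C * ‖· - b‖ ^ 2` other than `b` would carry a regular
  -- subgradient of norm `L + 2 * C * ‖u₀ - b‖ > L`.
  have hub : u₀ = b := by
    by_contra hne
    have hpos : 0 < ‖u₀ - b‖ := norm_pos_iff.2 (sub_ne_zero.2 hne)
    have hder : HasDerivAt (fun t => L * √t + C * t) (L * (1 / (2 * √(‖u₀ - b‖ ^ 2))) + C)
        (‖u₀ - b‖ ^ 2) := by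
      have h1 := (Real.hasDerivAt_sqrt (pow_pos hpos 2).ne').const_mul L
      have h2 := (hasDerivAt_id (‖u₀ - b‖ ^ 2)).const_mul C
      simpa using h1.fun_add h2
    have := hsub u₀ (hbR' hu₀) _ (hreg _ hder)
    rw [Real.sqrt_sq hpos.le, zero_sub, norm_neg, norm_smul,
      Real.norm_of_nonneg (by positivity)] at this
    have he : 2 * (L * (1 / (2 * ‖u₀ - b‖)) + C) * ‖u₀ - b‖ = L + 2 * C * ‖u₀ - b‖ := by
      field_simp
    rw [he] at this
    have : 0 < 2 * C * ‖u₀ - b‖ := by positivity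
    linarith
  subst hub
  have := hmin u (by
    rw [Metric.mem_closedBall, dist_eq_norm]
    have := norm_sub_le_norm_sub_add_norm_sub u q u₀
    rw [norm_sub_rev q u₀] at this
    linarith)
  rw [← EReal.coe_add, ← EReal.coe_add, EReal.coe_le_coe_iff,
    Real.sqrt_sq (norm_nonneg (u - u₀))] at this
  simp only [sub_self, norm_zero, inner_zero_left, ne_eq, OfNat.ofNat_ne_zero, not_false_eq_true,
    zero_pow, Real.sqrt_zero, mul_zero, add_zero, sub_zero] at this
  linarith

/-- The first-order remainder is at most `(s - t) ^ 2` for either sign of `s` and `t`. This function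
supplies a differentiable penalty that vanishes on an inner ball. -/
theorem hasDerivAt_sq_max_zero (t : ℝ) : HasDerivAt (fun s : ℝ => max 0 s ^ 2) (2 * max 0 t) t := by
  rw [hasDerivAt_iff_isLittleO]
  refine Asymptotics.IsBigO.trans_isLittleO (g := fun s => (s - t) ^ 2)
    (Asymptotics.IsBigO.of_bound 1 (Eventually.of_forall fun s => ?_)) ?_
  · rw [one_mul, Real.norm_eq_abs, Real.norm_eq_abs, abs_of_nonneg (sq_nonneg (s - t)), abs_le,
      smul_eq_mul]
    rcases le_total 0 s with hs | hs <;> rcases le_total 0 t with ht | ht <;>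
      simp only [max_eq_right hs, max_eq_left hs, max_eq_right ht, max_eq_left ht] <;>
      constructor <;> nlinarith [mul_nonneg_iff.2 (Or.inl ⟨sq_nonneg s, sq_nonneg t⟩)]
  · have h1 : Tendsto (fun s : ℝ => s - t) (𝓝 t) (𝓝 0) := by
      have : Continuous fun s : ℝ => s - t := by fun_prop
      simpa using this.tendsto t
    have := (Asymptotics.isBigO_refl (fun s : ℝ => s - t) (𝓝 t)).mul_isLittleO
      ((Asymptotics.isLittleO_one_iff ℝ).2 h1)
    simpa [sq] using this

/-- Local monotonicity of the subdifferential upgrades quadratic minorants to affine ones. -/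
theorem HasQuadraticMinorantsNear.zero_of_monotone [ProperSpace E] {φ : E → EReal} {xb vb : E}
    {r : ℝ} (hr : 0 ≤ r) (h : HasQuadraticMinorantsNear φ xb vb r) (hbot : ∀ x, φ x ≠ ⊥)
    (hφ : LowerSemicontinuous φ) {ρ : ℝ} (hρ : 0 < ρ)
    (hmono : ∀ x ∈ Metric.closedBall xb ρ, ∀ x' ∈ Metric.closedBall xb ρ,
      ∀ v ∈ Metric.closedBall vb ρ, ∀ v' ∈ Metric.closedBall vb ρ,
      v ∈ limitingSubdifferential φ x → v' ∈ limitingSubdifferential φ x' →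
      0 ≤ inner ℝ (v' - v) (x' - x)) :
    HasQuadraticMinorantsNear φ xb vb 0 := by
  obtain ⟨ε, hε, H⟩ := h
  -- `K` bounds the multiplier `m` below: `η ≤ 1`, and the penalty contributes at most `4 * C * (3 *
  -- δ ^ 2) = 12 * (r + 1)`. Dividing by `4 * K` in `δ` keeps the perturbed subgradient within `ρ`
  -- of `vb`.
  set K := 1 + 12 * (r + 1) with hK
  have hK1 : 1 ≤ K := by linarith
  set δ := min ε ρ / (4 * K) with hδdef
  have hδ : 0 < δ := by positivity
  have hKδ : 4 * (K * δ) = min ε ρ := by rw [hδdef]; field_simp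
  have hδK : δ ≤ K * δ := le_mul_of_one_le_left hδ.le hK1
  have hmε := min_le_left ε ρ
  have hmρ := min_le_right ε ρ
  refine ⟨δ / 2, by positivity, fun x hx u hu v hv huv => ?_⟩
  rw [Metric.mem_closedBall, dist_eq_norm] at hx hu hv
  obtain ⟨a, ha⟩ := exists_coe_eq huv.1 huv.2.1
  by_cases hxt : φ x = ⊤
  · simp [hxt]
  obtain ⟨b, hb⟩ := exists_coe_eq (hbot x) hxt
  have hball : ∀ y, ‖y - u‖ ≤ 2 * δ → ∀ c, 3 * δ ≤ c → y ∈ Metric.closedBall xb c := by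
    intro y hy c hc
    rw [Metric.mem_closedBall, dist_eq_norm]
    linarith [norm_sub_le_norm_sub_add_norm_sub y u xb]
  have hu0 : ‖u - u‖ ≤ 2 * δ := by simpa using hδ.le
  set C := (r + 1) / δ ^ 2 with hC
  have hC0 : 0 < C := by positivity
  have hCδ : C * δ ^ 2 = r + 1 := by rw [hC]; field_simp
  have hvε : v ∈ Metric.closedBall vb ε := by rw [Metric.mem_closedBall, dist_eq_norm]; linarith
  have hvρ : v ∈ Metric.closedBall vb ρ := by rw [Metric.mem_closedBall, dist_eq_norm]; linarith
  have key : ∀ η : ℝ, 0 < η → η ≤ 1 →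
      a + inner ℝ v (x - u) - η / 2 * ‖x - u‖ ^ 2 ≤ b := by
    intro η hη hη1
    -- The `C`-term vanishes within distance `δ` of `u`, hence at `x`, yet at distance `2 * δ` it
    -- equals `9 * (r + 1) * δ ^ 2` and outweighs the minorant's defect `2 * r * δ ^ 2`. Only the
    -- small weight `η` acts near `u`.
    obtain ⟨w, hw, -, hmin, hreg⟩ := exists_min_radial (R := 2 * δ) hbot (by positivity)
      (hφ.lowerSemicontinuousOn _) huv.2.1
      (h := fun t => η / 2 * t + C * max 0 (t - δ ^ 2) ^ 2) (by fun_prop) v (by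
        intro y hy
        rw [mem_sphere_iff_norm] at hy
        by_cases hyt : φ y = ⊤
        · rw [hyt, ha, EReal.top_add_coe, ← EReal.coe_add]
          exact EReal.coe_lt_top _
        obtain ⟨c, hc⟩ := exists_coe_eq (hbot y) hyt
        have h1 := add_le_of_coe_add_le ha hc (H y (hball y hy.le ε (by linarith)) u
          (hball u hu0 ε (by linarith)) v hvε huv)
        rw [ha, hc, ← EReal.coe_add, ← EReal.coe_add, EReal.coe_lt_coe_iff]
        rw [hy] at h1 ⊢
        have h2 : max 0 ((2 * δ) ^ 2 - δ ^ 2) = 3 * δ ^ 2 := by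
          rw [max_eq_right (by nlinarith)]; ring
        have h3 : max 0 ((0 : ℝ) - δ ^ 2) = 0 := max_eq_left (by nlinarith)
        have h4 : C * (3 * δ ^ 2) ^ 2 = 9 * (r + 1) * δ ^ 2 := by rw [← hCδ]; ring
        rw [h2, h3, h4]
        have h5 : 0 < δ ^ 2 := by positivity
        have h6 : 0 < η * δ ^ 2 := by positivity
        have h7 : 0 ≤ r * δ ^ 2 := by positivity
        nlinarith)
    rw [Metric.mem_ball, dist_eq_norm] at hw
    set t := ‖w - u‖ ^ 2 with ht
    have hder : HasDerivAt (fun t => η / 2 * t + C * max 0 (t - δ ^ 2) ^ 2)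
        (η / 2 + C * (2 * max 0 (t - δ ^ 2))) t := by
      have h1 := (hasDerivAt_id t).const_mul (η / 2)
      have h2 := ((hasDerivAt_sq_max_zero (t - δ ^ 2)).comp_sub_const t (δ ^ 2)).const_mul C
      simpa using h1.fun_add h2
    have hw' := regularSubdifferential_subset_limiting _ _ (hreg _ hder)
    set m := 2 * (η / 2 + C * (2 * max 0 (t - δ ^ 2))) with hm
    have hmax0 : 0 ≤ max 0 (t - δ ^ 2) := le_max_left _ _
    have hm0 : 0 < m := by positivity
    have hmK : m ≤ K := by
      have h1 : max 0 (t - δ ^ 2) ≤ 3 * δ ^ 2 := by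
        refine max_le (by positivity) ?_
        have : t ≤ (2 * δ) ^ 2 := pow_le_pow_left₀ (norm_nonneg _) hw.le 2
        nlinarith
      have h2 : C * max 0 (t - δ ^ 2) ≤ C * (3 * δ ^ 2) := mul_le_mul_of_nonneg_left h1 hC0.le
      nlinarith
    have hgrad : v - m • (w - u) ∈ Metric.closedBall vb ρ := by
      rw [Metric.mem_closedBall, dist_eq_norm]
      have h1 : v - m • (w - u) - vb = (v - vb) - m • (w - u) := by abel
      have h2 : ‖m • (w - u)‖ ≤ K * (2 * δ) := by
        rw [norm_smul, Real.norm_of_nonneg hm0.le]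
        exact mul_le_mul hmK hw.le (norm_nonneg _) (by linarith)
      rw [h1]
      linarith [norm_sub_le (v - vb) (m • (w - u))]
    have hmon := hmono u (hball u hu0 ρ (by linarith)) w (hball w hw.le ρ (by linarith)) v hvρ _
      hgrad huv hw'
    rw [sub_sub_cancel_left, inner_neg_left, inner_smul_left, real_inner_self_eq_norm_sq] at hmon
    simp only [conj_trivial] at hmon
    -- The subgradient at `w` is `v - m • (w - u)` with `m > 0`, so monotonicity against `(u, v)`
    -- would fail if `w ≠ u`.
    have hwu : w = u := by
      by_contra hne
      have h1 : 0 < ‖w - u‖ := norm_pos_iff.2 (sub_ne_zero.2 hne)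
      have : 0 < m * ‖w - u‖ ^ 2 := by positivity
      linarith
    have hxu : ‖x - u‖ ≤ δ := by
      have := norm_sub_le_norm_sub_add_norm_sub x xb u
      rw [norm_sub_rev xb u] at this
      linarith
    have hfin := hmin x (by rw [Metric.mem_closedBall, dist_eq_norm]; linarith)
    have h3 : max 0 (‖x - u‖ ^ 2 - δ ^ 2) = 0 := by
      refine max_eq_left ?_
      have := pow_le_pow_left₀ (norm_nonneg _) hxu 2
      linarith
    have h4 : max 0 (t - δ ^ 2) = 0 := by
      rw [ht, hwu]
      exact max_eq_left (by simp [sq_nonneg])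
    rw [h3, h4, hwu, ha, hb, ← EReal.coe_add, ← EReal.coe_add, EReal.coe_le_coe_iff, ht, hwu] at hfin
    simp only [sub_self, norm_zero, inner_zero_right] at hfin
    linarith
  rw [ha, hb, ← EReal.coe_add, EReal.coe_le_coe_iff]
  have hlim : Tendsto (fun η : ℝ => a + inner ℝ v (x - u) - η / 2 * ‖x - u‖ ^ 2) (𝓝[>] 0)
      (𝓝 (a + inner ℝ v (x - u))) := by
    have : Continuous fun η : ℝ => a + inner ℝ v (x - u) - η / 2 * ‖x - u‖ ^ 2 := by fun_prop
    simpa using (this.tendsto 0).mono_left nhdsWithin_le_nhds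
  have hev : ∀ᶠ η : ℝ in 𝓝[>] 0, η ≤ 1 :=
    mem_nhdsWithin_of_mem_nhds (Iic_mem_nhds one_pos)
  have := le_of_tendsto hlim (by
    filter_upwards [self_mem_nhdsWithin, hev] with η hη hη1 using key η hη hη1)
  linarith

end Integration

/-! ### The local resolvent and its Cayley transform. -/

section Resolvent

variable {E : Type*} [NormedAddCommGroup E] [InnerProductSpace ℝ E]

/-- Positive semidefiniteness of the combined second-order subdifferential forces local
monotonicity of the subdifferential in the presence of quadratic minorants. -/
theorem HasQuadraticMinorantsNear.exists_monotone_of_posSemidef [ProperSpace E] {φ : E → EReal}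
    {xb vb : E} {r : ℝ} (hr : 0 ≤ r) (h : HasQuadraticMinorantsNear φ xb vb r)
    (hbot : ∀ x, φ x ≠ ⊥) (hφ : LowerSemicontinuous φ) (hvb : vb ∈ limitingSubdifferential φ xb)
    (hpsd : IsPosSemidefNear (combinedSecondSubdifferential φ) φ xb vb) :
    ∃ ρ > (0 : ℝ), ∀ x ∈ Metric.closedBall xb ρ, ∀ x' ∈ Metric.closedBall xb ρ,
      ∀ v ∈ Metric.closedBall vb ρ, ∀ v' ∈ Metric.closedBall vb ρ,
      v ∈ limitingSubdifferential φ x → v' ∈ limitingSubdifferential φ x' →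
      0 ≤ inner ℝ (v' - v) (x' - x) := by
  obtain ⟨ε, hε, H⟩ := h
  obtain ⟨U, hU, V, hV, HD⟩ := hpsd
  obtain ⟨σ, hσ, hσU⟩ := Metric.mem_nhds_iff.1 hU
  obtain ⟨σ', hσ', hσV⟩ := Metric.mem_nhds_iff.1 hV
  set τ := min ε (min σ σ') with hτdef
  have hτ : 0 < τ := by positivity
  have hτε : τ ≤ ε := min_le_left _ _
  have hτσ : τ ≤ σ := (min_le_right _ _).trans (min_le_left _ _)
  have hτσ' : τ ≤ σ' := (min_le_right _ _).trans (min_le_right _ _)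
  have hcl : ∀ c : E, Metric.ball c τ ⊆ Metric.closedBall c ε := fun c =>
    Metric.ball_subset_closedBall.trans (Metric.closedBall_subset_closedBall hτε)
  set s := r + 1 with hs
  have hs0 : 0 < s := by positivity
  -- Since `s - r = 1`, the map `s • I + ∂φ` is locally strongly monotone with modulus one. Hence
  -- its inverse is single-valued and 1-Lipschitz.
  have hexp : ∀ x ∈ Metric.ball xb τ, ∀ x' ∈ Metric.ball xb τ, ∀ v ∈ Metric.ball vb τ,
      ∀ v' ∈ Metric.ball vb τ, v ∈ limitingSubdifferential φ x →
      v' ∈ limitingSubdifferential φ x' → ‖x' - x‖ ≤ ‖(s • x' + v') - (s • x + v)‖ := by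
    intro x hx x' hx' v hv v' hv' hxv hxv'
    have h1 := inner_sub_ge_of_minorants hxv hxv'
      (H x' (hcl _ hx') x (hcl _ hx) v (hcl _ hv) hxv)
      (H x (hcl _ hx) x' (hcl _ hx') v' (hcl _ hv') hxv')
    have h2 : (s • x' + v') - (s • x + v) = s • (x' - x) + (v' - v) := by module
    have h3 := real_inner_le_norm ((s • x' + v') - (s • x + v)) (x' - x)
    have h4 : inner ℝ ((s • x' + v') - (s • x + v)) (x' - x) =
        s * ‖x' - x‖ ^ 2 + inner ℝ (v' - v) (x' - x) := by
      rw [h2, inner_add_left, inner_smul_left, real_inner_self_eq_norm_sq]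
      simp
    by_contra hcon
    push Not at hcon
    nlinarith [norm_nonneg ((s • x' + v') - (s • x + v))]
  set q₀ := s • xb + vb with hq₀
  -- For `q` within `κ` of `q₀` the solution moves at most `2 * κ` and its subgradient at most `κ +
  -- 2 * s * κ`, both less than `τ`.
  set κ := τ / (4 * (1 + s)) with hκdef
  have hκ : 0 < κ := by positivity
  have hκτ : 4 * (κ + s * κ) = τ := by rw [hκdef]; field_simp
  have hsκ : 0 < s * κ := by positivity
  have hex : ∀ q, ∃ u, q ∈ Metric.closedBall q₀ κ → u ∈ Metric.ball xb τ ∧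
      q - s • u ∈ Metric.ball vb τ ∧ q - s • u ∈ limitingSubdifferential φ u := by
    intro q
    by_cases hq : q ∈ Metric.closedBall q₀ κ
    swap
    -- An arbitrary value outside the ball, so that `J` is a total function.
    · exact ⟨0, fun h => absurd h hq⟩
    rw [Metric.mem_closedBall, dist_eq_norm] at hq
    have hmem : xb ∈ Metric.closedBall xb ε := Metric.mem_closedBall_self hε.le
    have hmemv : vb ∈ Metric.closedBall vb ε := Metric.mem_closedBall_self hε.le
    obtain ⟨u, hu, hv⟩ := exists_perturbed_subgradient (R := ε) hbot hφ hvb.2.1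
      (fun x' hx' => H x' hx' xb hmem vb hmemv hvb) (e := q - q₀) (by linarith)
    have he : vb + (q - q₀) - (r + 1) • (u - xb) = q - s • u := by rw [hq₀, hs]; module
    rw [he] at hv
    refine ⟨u, fun _ => ⟨?_, ?_, regularSubdifferential_subset_limiting _ _ hv⟩⟩
    · rw [Metric.mem_ball, dist_eq_norm]
      linarith
    · rw [Metric.mem_ball, dist_eq_norm]
      have h1 : q - s • u - vb = (q - q₀) - s • (u - xb) := by rw [hq₀]; module
      have h2 : ‖s • (u - xb)‖ ≤ s * (2 * κ) := by
        rw [norm_smul, Real.norm_of_nonneg hs0.le]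
        exact mul_le_mul_of_nonneg_left (by linarith) hs0.le
      rw [h1]
      linarith [norm_sub_le (q - q₀) (s • (u - xb))]
  choose J hJ using hex
  have hJuniq : ∀ x ∈ Metric.ball xb τ, ∀ v ∈ Metric.ball vb τ, v ∈ limitingSubdifferential φ x →
      s • x + v ∈ Metric.closedBall q₀ κ → J (s • x + v) = x := by
    intro x hx v hv hxv hq
    obtain ⟨h1, h2, h3⟩ := hJ _ hq
    have h4 := hexp x hx _ h1 v hv _ h2 hxv h3
    rw [add_sub_cancel, sub_self, norm_zero] at h4
    exact sub_eq_zero.1 (norm_le_zero_iff.1 h4)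
  have hJcont : ContinuousOn J (Metric.closedBall q₀ κ) := by
    refine (LipschitzOnWith.of_dist_le_mul (K := 1) fun q hq q' hq' => ?_).continuousOn
    obtain ⟨h1, h2, h3⟩ := hJ q hq
    obtain ⟨h1', h2', h3'⟩ := hJ q' hq'
    have := hexp _ h1' _ h1 _ h2' _ h2 h3' h3
    rw [add_sub_cancel, add_sub_cancel] at this
    simpa [dist_eq_norm] using this
  have hbound : ∀ c : E, ∀ p ∈ Metric.ball q₀ κ, ∀ g ∈ regularSubdifferential
      (fun q => ((inner ℝ c ((2 * s) • J q - q) : ℝ) : EReal)) p, ‖g‖ ≤ ‖c‖ := by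
    intro c p hp g hg
    obtain ⟨hx, hy, hxy⟩ := hJ p (Metric.ball_subset_closedBall hp)
    set x := J p with hxdef
    -- In terms of graph increments `(a, b)`, the argument `q` changes by `s • a + b` and its Cayley
    -- image by `s • a - b`. Collecting `⟪g, s • a + b⟫ - ⟪c, s • a - b⟫` in `a` and `b` and
    -- dividing by `2 * s` gives this pair; its inner product is `(‖c‖ ^ 2 - ‖g‖ ^ 2) / (4 * s)`.
    have hz : (1 / 2 : ℝ) • (g - c) ∈
        combinedSecondSubdifferential φ x (p - s • x) (-((1 / (2 * s)) • (g + c))) := by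
      rw [combinedSecondSubdifferential, mem_regularCoderivative_iff]
      refine ⟨hxy, fun η hη => ?_⟩
      have hfst : Continuous fun p : WithLp 2 (E × E) => p.fst :=
        continuous_fst.comp (WithLp.prod_continuous_ofLp 2 E E)
      have hsnd : Continuous fun p : WithLp 2 (E × E) => p.snd :=
        continuous_snd.comp (WithLp.prod_continuous_ofLp 2 E E)
      have hq : Tendsto (fun p : WithLp 2 (E × E) => s • p.fst + p.snd)
          (𝓝 (WithLp.toLp 2 (x, p - s • x))) (𝓝 p) := by
        have h1 : Continuous fun p : WithLp 2 (E × E) => s • p.fst + p.snd :=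
          (hfst.const_smul s).add hsnd
        simpa using h1.tendsto (WithLp.toLp 2 (x, p - s • x))
      -- This tolerance becomes `η` after the bound `‖s • a + b‖ ≤ (s + 1) * ‖P - _‖` and the
      -- division by `2 * s`.
      filter_upwards [hq.eventually (hg.2.2 (2 * s * η / (s + 1)) (by positivity)),
        hq.eventually (Metric.isOpen_ball.mem_nhds hp),
        (hfst.tendsto (WithLp.toLp 2 (x, p - s • x))).eventually (Metric.isOpen_ball.mem_nhds hx),
        (hsnd.tendsto (WithLp.toLp 2 (x, p - s • x))).eventually (Metric.isOpen_ball.mem_nhds hy)]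
        with P hP1 hP2 hP3 hP4 hPT
      have hJP := hJuniq P.fst hP3 P.snd hP4 hPT (Metric.ball_subset_closedBall hP2)
      rw [hJP, ← EReal.coe_add, EReal.coe_le_coe_iff, ← hxdef] at hP1
      set a := P.fst - x with ha
      set b := P.snd - (p - s • x) with hb
      have hd : s • P.fst + P.snd - p = s • a + b := by rw [ha, hb]; module
      have hn : ‖s • a + b‖ ≤ (s + 1) * ‖P - WithLp.toLp 2 (x, p - s • x)‖ := by
        have h1 : ‖a‖ ≤ ‖P - WithLp.toLp 2 (x, p - s • x)‖ := WithLp.norm_fst_le E (P - WithLp.toLp 2 (x, p - s • x))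
        have h2 : ‖b‖ ≤ ‖P - WithLp.toLp 2 (x, p - s • x)‖ := WithLp.norm_snd_le E (P - WithLp.toLp 2 (x, p - s • x))
        have h3 : ‖s • a‖ = s * ‖a‖ := by rw [norm_smul, Real.norm_of_nonneg hs0.le]
        have h4 := mul_le_mul_of_nonneg_left h1 hs0.le
        linarith [norm_add_le (s • a) b]
      have he : (2 * s) • P.fst - (s • P.fst + P.snd) = ((2 * s) • x - p) + (s • a - b) := by
        rw [ha, hb]; module
      rw [hd, he, inner_add_right c] at hP1
      have hη := mul_le_mul_of_nonneg_left hn (a := 2 * s * η / (s + 1)) (by positivity)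
      have hη' : 2 * s * η / (s + 1) * ((s + 1) * ‖P - WithLp.toLp 2 (x, p - s • x)‖) =
          2 * s * (η * ‖P - WithLp.toLp 2 (x, p - s • x)‖) := by field_simp
      have hid : 2 * s * (inner ℝ ((1 / 2 : ℝ) • (g - c)) a -
          inner ℝ (-((1 / (2 * s)) • (g + c))) b) =
          inner ℝ g (s • a + b) - inner ℝ c (s • a - b) := by
        simp only [inner_smul_left, inner_neg_left, inner_add_left, inner_sub_left,
          inner_add_right, inner_sub_right, inner_smul_right, conj_trivial]
        field_simp
        ring
      refine le_of_mul_le_mul_left ?_ (by positivity : 0 < 2 * s)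
      rw [hid]
      linarith
    have := HD x (hσU (Metric.ball_subset_ball hτσ hx)) _ (hσV (Metric.ball_subset_ball hτσ' hy))
      hxy _ _ hz
    have hid : inner ℝ ((1 / 2 : ℝ) • (g - c)) (-((1 / (2 * s)) • (g + c))) =
        (1 / (4 * s)) * (‖c‖ ^ 2 - ‖g‖ ^ 2) := by
      simp only [inner_smul_left, inner_neg_right, inner_sub_left, inner_add_right,
        inner_smul_right, conj_trivial, real_inner_self_eq_norm_sq, real_inner_comm g c]
      field_simp
      ring
    rw [hid] at this
    have h2 := nonneg_of_mul_nonneg_right this (by positivity)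
    exact abs_le_of_sq_le_sq' (by linarith) (norm_nonneg c) |>.2
  have hRlip : ∀ q ∈ Metric.ball q₀ (κ / 4), ∀ q' ∈ Metric.ball q₀ (κ / 4),
      ‖((2 * s) • J q' - q') - ((2 * s) • J q - q)‖ ≤ ‖q' - q‖ := by
    intro q hq q' hq'
    -- Scalarizing along the increment itself turns the scalar Lipschitz bound into `‖c‖ ^ 2 ≤ ‖c‖ *
    -- ‖q' - q‖`.
    set c := ((2 * s) • J q' - q') - ((2 * s) • J q - q) with hc
    have h1 := sub_le_mul_norm_of_regularSubdifferential_bound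
      (f := fun q => inner ℝ c ((2 * s) • J q - q)) hκ (norm_nonneg c)
      (by fun_prop) (hbound c) hq' hq
    rw [← inner_sub_right, ← hc, real_inner_self_eq_norm_sq, norm_sub_rev q q'] at h1
    by_contra hcon
    push Not at hcon
    nlinarith [norm_nonneg (q' - q)]
  have hmem : ∀ x ∈ Metric.closedBall xb (κ / (8 * (1 + s))),
      ∀ v ∈ Metric.closedBall vb (κ / (8 * (1 + s))), x ∈ Metric.ball xb τ ∧
      v ∈ Metric.ball vb τ ∧ s • x + v ∈ Metric.ball q₀ (κ / 4) := by
    intro x hx v hv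
    rw [Metric.mem_closedBall, dist_eq_norm] at hx hv
    have hρκ : 8 * (κ / (8 * (1 + s)) + s * (κ / (8 * (1 + s)))) = κ := by field_simp
    have hρ : 0 < κ / (8 * (1 + s)) := by positivity
    have hsρ : 0 < s * (κ / (8 * (1 + s))) := by positivity
    refine ⟨?_, ?_, ?_⟩ <;> rw [Metric.mem_ball, dist_eq_norm]
    · linarith
    · linarith
    · have h1 : s • x + v - q₀ = s • (x - xb) + (v - vb) := by rw [hq₀]; module
      have h2 : ‖s • (x - xb)‖ ≤ s * (κ / (8 * (1 + s))) := by
        rw [norm_smul, Real.norm_of_nonneg hs0.le]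
        exact mul_le_mul_of_nonneg_left hx hs0.le
      rw [h1]
      linarith [norm_add_le (s • (x - xb)) (v - vb)]
  have hsub : Metric.ball q₀ (κ / 4) ⊆ Metric.closedBall q₀ κ :=
    Metric.ball_subset_closedBall.trans (Metric.closedBall_subset_closedBall (by linarith))
  refine ⟨κ / (8 * (1 + s)), by positivity, fun x hx x' hx' v hv v' hv' hxv hxv' => ?_⟩
  obtain ⟨h1, h2, h3⟩ := hmem x hx v hv
  obtain ⟨h1', h2', h3'⟩ := hmem x' hx' v' hv'
  have h4 := hRlip _ h3 _ h3'
  rw [hJuniq x h1 v h2 hxv (hsub h3), hJuniq x' h1' v' h2' hxv' (hsub h3')] at h4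
  have h5 : ((2 * s) • x' - (s • x' + v')) - ((2 * s) • x - (s • x + v)) =
      s • (x' - x) - (v' - v) := by module
  have h6 : (s • x' + v') - (s • x + v) = s • (x' - x) + (v' - v) := by module
  rw [h5, h6] at h4
  -- Squaring `‖s • a - b‖ ≤ ‖s • a + b‖` leaves only the cross term, which is monotonicity.
  have h7 := pow_le_pow_left₀ (norm_nonneg _) h4 2
  rw [norm_sub_sq_real, norm_add_sq_real, inner_smul_left, real_inner_comm] at h7
  simp only [conj_trivial] at h7
  have h8 : 0 ≤ s * inner ℝ (v' - v) (x' - x) := by linarith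
  exact nonneg_of_mul_nonneg_right h8 hs0

end Resolvent

end VarAnalysis

end

theorem theorem5p2 (n : ℕ) (φ : EuclideanSpace ℝ (Fin n) → EReal)
    (xb vb : EuclideanSpace ℝ (Fin n))
    (hφ : VarAnalysis.IsProper φ) (hx : φ xb ≠ ⊤)
    (hv : vb ∈ VarAnalysis.limitingSubdifferential φ xb)
    (hsc : VarAnalysis.IsSubdiffContinuousAt φ xb vb) :
    List.TFAE
      [VarAnalysis.IsVariationallyConvexAt φ xb vb,
       VarAnalysis.IsProxRegularAt φ xb vb ∧
         VarAnalysis.IsPosSemidefNear (VarAnalysis.combinedSecondSubdifferential φ) φ xb vb,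
       VarAnalysis.IsProxRegularAt φ xb vb ∧
         VarAnalysis.IsPosSemidefNear (VarAnalysis.limitingSecondSubdifferential φ) φ xb vb] := by
  tfae_have 1 → 2 := fun h =>
    have h0 := h.hasQuadraticMinorantsNear hsc
    ⟨h0.isProxRegularAt le_rfl h.1 hv, h0.isPosSemidefNear_combined hφ.1 h.1⟩
  tfae_have 2 → 3 := fun h => ⟨h.1, h.2.limiting⟩
  tfae_have 3 → 2 := fun h => ⟨h.1, h.2.combined⟩
  tfae_have 2 → 1 := by
    rintro ⟨hprox, hpsd⟩
    obtain ⟨r, hr, hq⟩ := hprox.hasQuadraticMinorantsNear hsc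
    obtain ⟨ρ, hρ, hmono⟩ := hq.exists_monotone_of_posSemidef hr hφ.1 hprox.1 hv hpsd
    exact (hq.zero_of_monotone hr hφ.1 hprox.1 hρ hmono).isVariationallyConvexAt hφ.1 hprox.1 hsc
  tfae_finish
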